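/- Let $\Gamma$ be a countably infinite discrete group acting continuously on a compact metrizable space $X$. Let $\mathcal{M}(X)$ be the space of Borel probability measures on $X$ with the weak$^*$-topology and the induced action of $\Gamma$ by push-forward, and for a positive integer $N$ let $\mathcal{M}_N(X)\subseteq\mathcal{M}(X)$ be the $\Gamma$-invariant subspace of measures whose support has at most $N$ points. For an action of $\Gamma$ on a topological space $Y$, a positive integer $k$ and subsets $A_1,\dots,A_k\subseteq Y$, a set $F\subseteq\Gamma$ is called an independence set for $(A_1,\dots,A_k)$ if $\bigcap_{s\in J}s^{-1}A_{\sigma(s)}\neq\emptyset$ for every nonempty finite set $J\subseteq F$ and every map $\sigma:J\to\{1,\dots,k\}$. Let $\mathrm{IN}_k(Y)\subseteq Y^k$ be the set of all $(y_1,\dots,y_k)$ such that for every choice of neighborhoods $U_j$ of $y_j$ in $Y$ $(1\le j\le k)$, the tuple $(U_1,\dots,U_k)$ has independence sets of arbitrarily large finite cardinality. Then for all positive integers $k$ and $N_1,\dots,N_k$, setting $N=\prod_{j=1}^k N_j$, one has $$\bigl(\mathcal{M}_{N_1}(X)\times\cdots\times\mathcal{M}_{N_k}(X)\bigr)\cap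 \mathrm{IN}_k(\mathcal{M}(X))\subseteq \mathrm{IN}_k(\mathcal{M}_N(X)),$$ where $\mathrm{IN}_k(\mathcal{M}_N(X))\subseteq\mathcal{M}_N(X)^k$ is computed for the action of $\Gamma$ on $\mathcal{M}_N(X)$ with the subspace topology and is regarded as a subset of $\mathcal{M}(X)^k$. -/

import Mathlib

open MeasureTheory Topology Filter

/-- The induced action of `Γ` on the Borel probability measures on `X`, by push-forward:
`(g • μ)(A) = μ(g⁻¹ A)`.  The space `ProbabilityMeasure X` carries Mathlib's topology of weak
convergence, i.e. the weak-* topology coming from continuous functions on `X`. -/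
noncomputable instance probabilityMeasureMulAction {Γ X : Type*} [Group Γ] [MulAction Γ X]
    [TopologicalSpace X] [ContinuousConstSMul Γ X] [MeasurableSpace X] [BorelSpace X] :
    MulAction Γ (ProbabilityMeasure X) where
  smul g μ := μ.map (f := fun x : X => g • x) (measurable_const_smul g).aemeasurable
  one_smul μ := by
    apply Subtype.ext
    change Measure.map (fun x : X => (1 : Γ) • x) (μ : Measure X) = (μ : Measure X)
    simp
  mul_smul g h μ := by
    apply Subtype.ext
    change Measure.map (fun x : X => (g * h) • x) (μ : Measure X) =
      Measure.map (fun x : X => g • x) (Measure.map (fun x : X => h • x) (μ : Measure X))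
    rw [Measure.map_map (measurable_const_smul g) (measurable_const_smul h)]
    congr 1
    funext x
    exact mul_smul g h x

theorem probabilityMeasure_toMeasure_smul {Γ X : Type*} [Group Γ] [MulAction Γ X]
    [TopologicalSpace X] [ContinuousConstSMul Γ X] [MeasurableSpace X] [BorelSpace X]
    (g : Γ) (μ : ProbabilityMeasure X) :
    ((g • μ : ProbabilityMeasure X) : Measure X) =
      (μ : Measure X).map (fun x : X => g • x) := rfl

/-- The support of `g • μ` is contained in the translate by `g` of the support of `μ`. -/
theorem support_smul_subset {Γ X : Type*} [Group Γ] [MulAction Γ X]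
    [TopologicalSpace X] [ContinuousConstSMul Γ X] [MeasurableSpace X] [BorelSpace X]
    (g : Γ) (μ : ProbabilityMeasure X) :
    ((g • μ : ProbabilityMeasure X) : Measure X).support ⊆
      (fun x : X => g • x) '' (μ : Measure X).support := by
  intro y hy
  refine ⟨g⁻¹ • y, ?_, smul_inv_smul g y⟩
  rw [Measure.mem_support_iff_forall] at hy ⊢
  intro U hU
  have hV : (fun x : X => g⁻¹ • x) ⁻¹' U ∈ 𝓝 y :=
    (continuous_const_smul g⁻¹).continuousAt.preimage_mem_nhds hU
  have h := hy _ hV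
  rw [probabilityMeasure_toMeasure_smul,
    show (fun x : X => g • x) = (Homeomorph.smul g).toMeasurableEquiv from rfl,
    MeasurableEquiv.map_apply] at h
  convert h using 2
  ext x
  simp

/-- `F ⊆ Γ` is an independence set for the tuple `A = (A₁, …, A_k)` of subsets of `Y`:
`⋂_{s ∈ J} s⁻¹ A_{σ(s)} ≠ ∅` for every nonempty finite `J ⊆ F` and every `σ : J → {1, …, k}`.
Here `s⁻¹ A = {y | s y ∈ A}`. -/
def IsIndependenceSet {Γ Y : Type*} [SMul Γ Y] {k : ℕ} (A : Fin k → Set Y) (F : Set Γ) : Prop :=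
  ∀ J : Finset Γ, J.Nonempty → (J : Set Γ) ⊆ F → ∀ σ : J → Fin k,
    (⋂ s : J, (fun y : Y => (s : Γ) • y) ⁻¹' A (σ s)).Nonempty

/-- The set of IN-tuples of length `k` of the action of `Γ` on `Y`: those `y ∈ Y^k` such that for
every product neighbourhood `U₁ × ⋯ × U_k` of `y`, the tuple `(U₁, …, U_k)` has arbitrarily large
finite independence sets. -/
def INTuples (Γ Y : Type*) [SMul Γ Y] [TopologicalSpace Y] (k : ℕ) : Set (Fin k → Y) :=
  {y | ∀ U : Fin k → Set Y, (∀ j, U j ∈ 𝓝 (y j)) →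
    ∀ n : ℕ, ∃ F : Finset Γ, n ≤ F.card ∧ IsIndependenceSet U (F : Set Γ)}

/-- The `Γ`-invariant set of Borel probability measures on `X` whose support has at most `N`
points.  As a type it carries the subspace topology and the restricted action of `Γ`. -/
def finSuppMeasures (Γ X : Type*) [Group Γ] [MulAction Γ X]
    [TopologicalSpace X] [ContinuousConstSMul Γ X] [MeasurableSpace X] [BorelSpace X] (N : ℕ) :
    SubMulAction Γ (ProbabilityMeasure X) where
  carrier := {μ | (μ : Measure X).support.encard ≤ N}
  smul_mem' g μ hμ :=
    (Set.encard_le_encard (support_smul_subset g μ)).trans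
      ((Set.encard_image_le _ _).trans hμ)

/-! Near a finitely supported measure, closeness means giving almost the mass of each atom `x` to a
small neighbourhood `V x`. Take a long independence set for such neighbourhoods of the `μ j`.
Ramsey's theorem makes the patterns of visits to the sets `V j x` homogeneous along a long sequence
of group elements, which is cut into blocks of length `k`. Choices `φ` of one atom per `μ j` then
split in two. For `φ ∈ G`, the sets `V j (φ j)` are independent along the chosen elements. For `φ ∉
G`, no point follows `φ` through many blocks, so in some block these `φ` carry little mass
(`exists_independent_choices`). By independence some `ν` is moved near `μ j` by the `j`-th element
of every block. In the good block almost every point follows some `φ ∈ G`; sending it to a point `z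
φ` that realises the required pattern gives a measure with at most `∏ N j` atoms and nearly the same
masses (`exists_finite_support_measure`). -/

/-! ### Finite Ramsey theorem -/

/-- End-homogeneous sets for colourings of `(m + 1)`-tuples, given Ramsey's theorem for
`m`-tuples. -/
theorem exists_endHomogeneous {κ : Type*} {m : ℕ}
    (ramsey : ∀ L : ℕ, ∃ M : ℕ, ∀ (c : (Fin m → ℕ) → κ) (s : Finset ℕ), M ≤ s.card →
      ∃ t ⊆ s, L ≤ t.card ∧ ∃ d, ∀ a : Fin m → ℕ, StrictMono a → (∀ i, a i ∈ t) → c a = d)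
    (r : ℕ) :
    ∃ M : ℕ, ∀ (c : (Fin (m + 1) → ℕ) → κ) (s : Finset ℕ), M ≤ s.card →
      ∃ t ⊆ s, r ≤ t.card ∧ ∃ d : ℕ → κ, ∀ a : Fin (m + 1) → ℕ, StrictMono a →
        (∀ i, a i ∈ t) → c a = d (a 0) := by
  induction r with
  | zero =>
    refine ⟨0, fun c s _ => ⟨∅, by simp, by simp, fun _ => c fun _ => 0, fun a _ ha => ?_⟩⟩
    simpa using ha 0
  | succ r ih =>
    obtain ⟨M, hM⟩ := ih
    obtain ⟨M', hM'⟩ := ramsey M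
    refine ⟨M' + 1, fun c s hs => ?_⟩
    have hne : s.Nonempty := Finset.card_pos.mp (by omega)
    -- The minimum can precede any increasing tuple, so fixing it as first entry colours `m`-tuples.
    set x := s.min' hne with hx
    have hxs : x ∈ s := s.min'_mem hne
    obtain ⟨t', ht's, ht'M, d', hd'⟩ := hM' (fun a => c (Fin.cons x a)) (s.erase x)
      (by rw [Finset.card_erase_of_mem hxs]; omega)
    obtain ⟨t, htt', htr, d, hd⟩ := hM c t' ht'M
    have hxt : x ∉ t := fun h => by simpa using ht's (htt' h)
    have hts : t ⊆ s := htt'.trans (ht's.trans (Finset.erase_subset _ _))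
    refine ⟨insert x t, Finset.insert_subset hxs hts, ?_, Function.update d x d',
      fun a ha hat => ?_⟩
    · rw [Finset.card_insert_of_notMem hxt]; omega
    have hmem : ∀ i, x < a i → a i ∈ t := fun i hi =>
      (Finset.mem_insert.mp (hat i)).resolve_left hi.ne'
    by_cases h0 : a 0 = x
    · rw [h0, Function.update_self, ← hd' (Fin.tail a), ← h0, Fin.cons_self_tail]
      · exact fun i j hij => ha (Fin.succ_lt_succ_iff.mpr hij)
      · exact fun i => htt' (hmem _ (h0 ▸ ha (Fin.succ_pos i)))
    · rw [Function.update_of_ne h0]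
      have h0t : a 0 ∈ t := (Finset.mem_insert.mp (hat 0)).resolve_left h0
      have hx0 : x < a 0 := lt_of_le_of_ne (s.min'_le _ (hts h0t)) (Ne.symm h0)
      exact hd a ha fun i => hmem i (hx0.trans_le (ha.monotone (Fin.zero_le i)))

/-- The finite Ramsey theorem for colourings of increasing `m`-tuples of natural numbers. -/
theorem exists_homogeneous (κ : Type*) [Finite κ] (m : ℕ) (L : ℕ) :
    ∃ M : ℕ, ∀ (c : (Fin m → ℕ) → κ) (s : Finset ℕ), M ≤ s.card →
      ∃ t ⊆ s, L ≤ t.card ∧ ∃ d, ∀ a : Fin m → ℕ, StrictMono a → (∀ i, a i ∈ t) → c a = d := by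
  classical
  induction m generalizing L with
  | zero =>
    exact ⟨L, fun c s hs => ⟨s, subset_rfl, hs, c default, fun a _ _ =>
      congrArg c (Subsingleton.elim _ _)⟩⟩
  | succ m ih =>
    have := Fintype.ofFinite κ
    obtain ⟨M, hM⟩ := exists_endHomogeneous ih (Fintype.card κ * L)
    refine ⟨M, fun c s hs => ?_⟩
    obtain ⟨t, hts, ht, d, hd⟩ := hM c s hs
    obtain ⟨y, -, hy⟩ := Finset.exists_le_card_fiber_of_mul_le_card_of_maps_to
      (s := t) (t := Finset.univ) (f := d) (n := L) (fun _ _ => Finset.mem_univ _)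
      ⟨c fun _ => 0, Finset.mem_univ _⟩ (by simpa using ht)
    refine ⟨{x ∈ t | d x = y}, (Finset.filter_subset _ _).trans hts, hy, y, fun a ha hat => ?_⟩
    rw [hd a ha fun i => (Finset.mem_filter.mp (hat i)).1]
    exact (Finset.mem_filter.mp (hat 0)).2

/-! ### Neighbourhoods of finitely supported measures -/

/-- A measure concentrated on a finite set is the sum of its atoms. -/
theorem measure_eq_sum_atoms {X : Type*} [MeasurableSpace X] [MeasurableSingletonClass X]
    (μ : Measure X) (S : Finset X) (hS : μ (S : Set X)ᶜ = 0) (G : Set X) [DecidablePred (· ∈ G)] :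
    μ G = ∑ x ∈ S with x ∈ G, μ {x} := by
  have h0 : μ (G \ S) = 0 := measure_mono_null (t := (S : Set X)ᶜ) (fun x hx => hx.2) hS
  rw [sum_measure_singleton, ← measure_inter_add_sdiff G S.measurableSet, h0, add_zero]
  congr 1
  ext x
  simp [and_comm]

/-- A finitely supported measure `μ` has arbitrarily small neighbourhoods consisting of the
measures that give almost the mass `μ {x}` to a neighbourhood of each atom `x`. -/
theorem exists_forall_measure_le_imp_mem {X : Type*} [TopologicalSpace X]
    [TopologicalSpace.MetrizableSpace X] [MeasurableSpace X] [BorelSpace X]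
    (μ : ProbabilityMeasure X) (S : Finset X) (hS : (μ : Measure X) (S : Set X)ᶜ = 0)
    {U : Set (ProbabilityMeasure X)} (hU : U ∈ 𝓝 μ) :
    ∃ (V : X → Set X) (ε : ENNReal), 0 < ε ∧ (∀ x ∈ S, IsOpen (V x) ∧ x ∈ V x) ∧
      (S : Set X).PairwiseDisjoint V ∧
      ∀ ν : ProbabilityMeasure X,
        (∀ x ∈ S, (μ : Measure X) {x} ≤ (ν : Measure X) (V x) + ε) → ν ∈ U := by
  classical
  let _ := TopologicalSpace.metrizableSpaceMetric X
  obtain ⟨V₀, hV₀, hdisj⟩ := S.finite_toSet.t2_separation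
  let V : ℕ → X → Set X := fun n x => Metric.ball x (1 / ((n : ℝ) + 1)) ∩ V₀ x
  let ε : ℕ → ENNReal := fun n => ((n : ENNReal) + 1)⁻¹
  have hε : Tendsto ε atTop (𝓝 0) := by
    have := (tendsto_add_atTop_iff_nat 1).mpr ENNReal.tendsto_inv_nat_nhds_zero
    simpa [ε] using this
  -- Otherwise shrinking balls give measures outside `U` that converge to `μ` by the portmanteau
  -- theorem.
  by_contra! hcon
  have key : ∀ n, ∃ ν : ProbabilityMeasure X,
      (∀ x ∈ S, (μ : Measure X) {x} ≤ (ν : Measure X) (V n x) + ε n) ∧ ν ∉ U := by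
    intro n
    refine hcon (V n) (ε n) (by simp [ε]) (fun x _ => ⟨Metric.isOpen_ball.inter (hV₀ x).2,
      Metric.mem_ball_self (by positivity), (hV₀ x).1⟩) ?_
    exact hdisj.mono fun x => Set.inter_subset_right
  choose ν hν hνU using key
  have hlim : Tendsto ν atTop (𝓝 μ) := by
    refine tendsto_of_forall_isOpen_le_liminf' fun G hG => ?_
    refine ENNReal.le_of_forall_pos_le_add fun δ hδ _ => ?_
    rw [← tsub_le_iff_right]
    refine le_liminf_of_le (by isBoundedDefault) ?_
    have h1 : ∀ᶠ n in atTop, ∀ x ∈ S, x ∈ G → V n x ⊆ G := by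
      rw [eventually_all_finset]
      intro x _
      by_cases hx : x ∈ G
      · obtain ⟨r, hr, hrG⟩ := Metric.isOpen_iff.mp hG x hx
        have := (tendsto_one_div_add_atTop_nhds_zero_nat (𝕜 := ℝ)).eventually_lt_const hr
        filter_upwards [this] with n hn _
        exact (Set.inter_subset_left.trans (Metric.ball_subset_ball hn.le)).trans hrG
      · exact Eventually.of_forall fun _ h => absurd h hx
    have h2 : ∀ᶠ n in atTop, (S.card : ENNReal) * ε n ≤ δ := by
      have : Tendsto (fun n => (S.card : ENNReal) * ε n) atTop (𝓝 (S.card * 0)) :=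
        ENNReal.Tendsto.const_mul hε (Or.inr (by simp))
      rw [mul_zero] at this
      exact (this.eventually_lt_const (ENNReal.coe_pos.mpr hδ)).mono fun _ h => h.le
    filter_upwards [h1, h2] with n hn1 hn2
    rw [tsub_le_iff_right]
    calc (μ : Measure X) G = ∑ x ∈ S with x ∈ G, (μ : Measure X) {x} :=
          measure_eq_sum_atoms _ S hS G
      _ ≤ ∑ x ∈ S with x ∈ G, ((ν n : Measure X) (V n x) + ε n) :=
          Finset.sum_le_sum fun x hx => hν n x (Finset.mem_filter.mp hx).1
      _ = ∑ x ∈ S with x ∈ G, (ν n : Measure X) (V n x) +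
            ((S.filter (· ∈ G)).card : ENNReal) * ε n := by
          rw [Finset.sum_add_distrib, Finset.sum_const, nsmul_eq_mul]
      _ ≤ (ν n : Measure X) G + δ := by
          gcongr ?_ + ?_
          · rw [← measure_biUnion_finset]
            · exact measure_mono (Set.iUnion₂_subset fun x hx =>
                hn1 x (Finset.mem_filter.mp hx).1 (Finset.mem_filter.mp hx).2)
            · exact (hdisj.subset (Finset.coe_subset.mpr (Finset.filter_subset _ _))).mono fun x => Set.inter_subset_right
            · exact fun x _ => (Metric.isOpen_ball.inter (hV₀ x).2).measurableSet
          · refine le_trans ?_ hn2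
            gcongr
            exact Finset.filter_subset _ _
  obtain ⟨n, hn⟩ := (hlim.eventually_mem hU).exists
  exact hνU n hn

/-- Mass of an open set is lower semicontinuous under weak convergence. -/
theorem setOf_forall_measure_le_mem_nhds {X : Type*} [TopologicalSpace X]
    [TopologicalSpace.MetrizableSpace X] [MeasurableSpace X] [BorelSpace X]
    (μ : ProbabilityMeasure X) (S : Finset X) (V : X → Set X)
    (hV : ∀ x ∈ S, IsOpen (V x) ∧ x ∈ V x) {ε : ENNReal} (hε : 0 < ε) :
    {ν : ProbabilityMeasure X | ∀ x ∈ S, (μ : Measure X) {x} ≤ (ν : Measure X) (V x) + ε} ∈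
      𝓝 μ := by
  rw [← eventually_iff, eventually_all_finset]
  intro x hx
  have hle : (μ : Measure X) {x} ≤ (μ : Measure X) (V x) :=
    measure_mono (Set.singleton_subset_iff.mpr (hV x hx).2)
  by_cases h0 : (μ : Measure X) {x} = 0
  · simp [h0]
  have hlt : (μ : Measure X) {x} - ε < (μ : Measure X) (V x) :=
    (ENNReal.sub_lt_self (measure_ne_top _ _) h0 hε.ne').trans_le hle
  have hlim := hlt.trans_le
    (ProbabilityMeasure.le_liminf_measure_open_of_tendsto tendsto_id (hV x hx).1)
  filter_upwards [eventually_lt_of_lt_liminf hlim] with ν hν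
  exact tsub_le_iff_right.mp hν.le

/-! ### Ramsey selection of independent choices -/

/-- If every point lies in at most `m` of finitely many sets, then the measures of these sets
add up to at most `m` times the total mass. -/
theorem sum_measure_le_of_card_le {X ι : Type*} [MeasurableSpace X] [Fintype ι]
    (ν : Measure X) [IsProbabilityMeasure ν] (E : ι → Set X) (hE : ∀ b, MeasurableSet (E b))
    (m : ℕ) (h : ∀ y, ∀ B : Finset ι, (∀ b ∈ B, y ∈ E b) → B.card ≤ m) :
    ∑ b, ν (E b) ≤ m := by
  classical
  calc ∑ b, ν (E b) = ∑ b, ∫⁻ y, (E b).indicator 1 y ∂ν := by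
        simp_rw [lintegral_indicator_one (hE _)]
    _ = ∫⁻ y, ∑ b, (E b).indicator 1 y ∂ν :=
        (lintegral_finsetSum _ fun b _ => measurable_one.indicator (hE b)).symm
    _ ≤ ∫⁻ _, (m : ENNReal) ∂ν := by
        refine lintegral_mono fun y => ?_
        simp only [Set.indicator_apply, Pi.one_apply, Finset.sum_boole]
        exact_mod_cast h y _ fun b hb => (Finset.mem_filter.mp hb).2
    _ = m := by simp

/-- Ramsey-type selection: along any sufficiently long sequence of maps `g i`, one can choose an
`m`-element set `A` of indices and a set `G` of choice functions `φ` such that every tuple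
`(V j (φ j))` with `φ ∈ G` is independent along `A`, and a labelling `σ` such that for every
probability measure `ν`, most points visit the tuple `(V j (φ j))` along a suitable transversal of
`σ` only for `φ ∈ G`. -/
theorem exists_independent_choices {X : Type*} [MeasurableSpace X] {k : ℕ} (hk : 1 ≤ k)
    {I : Fin k → Type*} [∀ j, Finite (I j)] (V : ∀ j, I j → Set X)
    (hV : ∀ j x, MeasurableSet (V j x)) (m : ℕ) {δ : ENNReal} (hδ : 0 < δ) :
    ∃ M : ℕ, ∀ g : ℕ → X → X, (∀ i, Measurable (g i)) → ∀ s : Finset ℕ, M ≤ s.card →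
      ∃ (σ : ℕ → Fin k) (A : Finset ℕ) (G : Set (∀ j, I j)), A ⊆ s ∧ A.card = m ∧
        (∀ φ ∈ G, ∀ τ : ℕ → Fin k, ∃ y, ∀ i ∈ A, g i y ∈ V (τ i) (φ (τ i))) ∧
        ∀ ν : Measure X, IsProbabilityMeasure ν → ∃ e : Fin k → ℕ,
          (∀ j, e j ∈ s ∧ σ (e j) = j) ∧
          ν {y | ∃ φ ∉ G, ∀ j, g (e j) y ∈ V j (φ j)} ≤ δ := by
  classical
  have := fun j => Fintype.ofFinite (I j)
  obtain ⟨n₀, hn₀⟩ := ENNReal.exists_nat_mul_gt (a := δ)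
    (b := Fintype.card (∀ j, I j) * (m : ENNReal)) hδ.ne' (by finiteness)
  obtain ⟨n, hn₀n, hmn⟩ : ∃ n, n₀ ≤ n ∧ m ≤ n := ⟨max n₀ m, le_max_left _ _, le_max_right _ _⟩
  have hn : Fintype.card (∀ j, I j) * (m : ENNReal) < n * δ := hn₀.trans_le (by gcongr)
  obtain ⟨M, hM⟩ := exists_homogeneous (Set (Fin m → Σ j, I j)) m (n * k)
  refine ⟨M, fun g hg s hs => ?_⟩
  obtain ⟨t, hts, ht, d, hd⟩ :=
    hM (fun a => {p | ∃ y, ∀ i, g (a i) y ∈ V (p i).1 (p i).2}) s hs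
  let E : Fin (n * k) ↪o ℕ := t.orderEmbOfCardLe ht
  have hEt : ∀ l, E l ∈ t := fun l => t.orderEmbOfCardLe_mem ht l
  -- Entries of successive blocks increase whatever positions are picked, so homogeneity applies to
  -- every transversal of blocks.
  let e : Fin n → Fin k → ℕ := fun b j => E (finProdFinEquiv (b, j))
  have he : ∀ b b' j j', b < b' → e b j < e b' j' := by
    intro b b' j j' hbb
    refine E.strictMono ?_
    simp only [Fin.lt_def, finProdFinEquiv_apply_val]
    have h1 : k * (b + 1) ≤ k * b' := Nat.mul_le_mul_left k hbb
    have h2 := j.isLt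
    rw [mul_add] at h1
    omega
  let a₀ : Fin m → ℕ := fun i => e (Fin.castLE hmn i) ⟨0, hk⟩
  have ha₀ : StrictMono a₀ := fun i i' hii => he _ _ _ _ hii
  let G : Set (∀ j, I j) := {φ | ∀ τ : Fin m → Fin k, (fun i => ⟨τ i, φ (τ i)⟩) ∈ d}
  refine ⟨Function.extend E (fun l => (finProdFinEquiv.symm l).2) fun _ => ⟨0, hk⟩,
    Finset.univ.image a₀, G, ?_, ?_, ?_, ?_⟩
  · intro i hi
    obtain ⟨l, -, rfl⟩ := Finset.mem_image.mp hi
    exact hts (hEt _)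
  · rw [Finset.card_image_of_injective _ ha₀.injective, Finset.card_fin]
  · intro φ hφ τ
    have := hφ (τ ∘ a₀)
    rw [← hd a₀ ha₀ fun i => hEt _] at this
    obtain ⟨y, hy⟩ := this
    refine ⟨y, fun i hi => ?_⟩
    obtain ⟨l, -, rfl⟩ := Finset.mem_image.mp hi
    exact hy l
  · intro ν hν
    suffices h : ∃ b, ν {y | ∃ φ ∉ G, ∀ j, g (e b j) y ∈ V j (φ j)} ≤ δ by
      obtain ⟨b, hb⟩ := h
      refine ⟨e b, fun j => ⟨hts (hEt _), ?_⟩, hb⟩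
      rw [E.injective.extend_apply, Equiv.symm_apply_apply]
    by_contra! hcon
    refine lt_irrefl ((n : ENNReal) * δ) ?_
    -- Some pattern `τ` of `φ` is missing from `d`; a point following `φ` through `m` blocks would
    -- realise it.
    have hbad : ∀ φ ∉ G, ∑ b, ν {y | ∀ j, g (e b j) y ∈ V j (φ j)} ≤ m := by
      intro φ hφ
      refine sum_measure_le_of_card_le ν _ (fun b => ?_) m fun y B hB => ?_
      · simp only [Set.ofPred_forall]
        exact MeasurableSet.iInter fun j => hg _ (hV j _)
      · by_contra! hlt
        obtain ⟨τ, hτ⟩ := not_forall.mp hφ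
        let β := B.orderEmbOfCardLe hlt.le
        refine hτ ?_
        rw [← hd (fun i => e (β i) (τ i)) (fun i i' hii => he _ _ _ _ (β.strictMono hii))
          fun i => hEt _]
        exact ⟨y, fun i => hB _ (B.orderEmbOfCardLe_mem hlt.le i) _⟩
    calc (n : ENNReal) * δ = ∑ _b : Fin n, δ := by simp
      _ ≤ ∑ b, ν {y | ∃ φ ∉ G, ∀ j, g (e b j) y ∈ V j (φ j)} :=
          Finset.sum_le_sum fun b _ => (hcon b).le
      _ ≤ ∑ b, ∑ φ with φ ∉ G, ν {y | ∀ j, g (e b j) y ∈ V j (φ j)} := by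
          refine Finset.sum_le_sum fun b _ => (measure_mono ?_).trans
            (measure_biUnion_finset_le _ _)
          rintro y ⟨φ, hφ, hy⟩
          exact Set.mem_biUnion (Finset.mem_coe.mpr (by simpa using hφ)) hy
      _ = ∑ φ with φ ∉ G, ∑ b, ν {y | ∀ j, g (e b j) y ∈ V j (φ j)} := Finset.sum_comm
      _ ≤ ∑ φ : ∀ j, I j with φ ∉ G, (m : ENNReal) :=
          Finset.sum_le_sum fun φ hφ => hbad φ (Finset.mem_filter.mp hφ).2
      _ ≤ ∑ _φ : ∀ j, I j, (m : ENNReal) := Finset.sum_le_sum_of_subset (Finset.filter_subset _ _)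
      _ = Fintype.card (∀ j, I j) * (m : ENNReal) := by simp
      _ < n * δ := hn

/-! ### Replacing a measure by a finitely supported one -/

/-- Push a measure `ν` forward along a finitely valued map that sends the cell
`⋂ j, D j (φ j)` to `z φ` for `φ ∈ G`. -/
theorem exists_finite_support_measure {X : Type*} [TopologicalSpace X] [T1Space X]
    [MeasurableSpace X] [BorelSpace X] {k : ℕ} {I : Fin k → Type*} [∀ j, Finite (I j)]
    (D : ∀ j, I j → Set X) (hD : ∀ j x, MeasurableSet (D j x))
    (hdisj : ∀ j, Pairwise (Function.onFun Disjoint (D j)))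
    (ν : ProbabilityMeasure X) (G : Set (∀ j, I j)) (hG : G.Nonempty) (z : (∀ j, I j) → X) :
    ∃ ρ : ProbabilityMeasure X, (ρ : Measure X).support.encard ≤ Nat.card (∀ j, I j) ∧
      ∀ (W : Set X) (j : Fin k) (x : I j), MeasurableSet W → (∀ φ ∈ G, φ j = x → z φ ∈ W) →
        (ν : Measure X) (D j x) ≤
          (ρ : Measure X) W + (ν : Measure X) {y | ¬ ∃ φ ∈ G, ∀ j, y ∈ D j (φ j)} := by
  classical
  obtain ⟨φ₀, -⟩ := hG
  let P : X → Prop := fun y => ∃ φ ∈ G, ∀ j, y ∈ D j (φ j)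
  -- Disjointness makes `φ` unique; the default `z φ₀` keeps the values in the range of `z`.
  let h : X → X := fun y => if hy : P y then z hy.choose else z φ₀
  have hz : ∀ y, ∀ φ ∈ G, (∀ j, y ∈ D j (φ j)) → h y = z φ := by
    intro y φ hφ hy
    have hP : P y := ⟨φ, hφ, hy⟩
    simp only [h, dif_pos hP]
    congr 1
    funext j
    by_contra hne
    exact Set.disjoint_left.mp (hdisj j hne) (hP.choose_spec.2 j) (hy j)
  have hcell : ∀ φ : ∀ j, I j, MeasurableSet {y | ∀ j, y ∈ D j (φ j)} := by
    intro φ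
    simp only [Set.ofPred_forall]
    exact MeasurableSet.iInter fun j => hD j _
  have hP : MeasurableSet {y | P y} := by
    have : {y | P y} = ⋃ φ ∈ G, {y | ∀ j, y ∈ D j (φ j)} := by ext; simp [P]
    rw [this]
    exact MeasurableSet.biUnion G.to_countable fun φ _ => hcell φ
  have hh : Measurable h := by
    intro W _
    have : h ⁻¹' W = (⋃ φ ∈ {φ ∈ G | z φ ∈ W}, {y | ∀ j, y ∈ D j (φ j)}) ∪
        ({y | P y}ᶜ ∩ {_y | z φ₀ ∈ W}) := by
      ext y
      simp only [Set.mem_preimage, Set.mem_union, Set.mem_iUnion, Set.mem_inter_iff,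
        Set.mem_compl_iff, Set.mem_ofPred_eq, exists_prop]
      by_cases hy : P y
      · obtain ⟨φ, hφ, hyφ⟩ := id hy
        simp only [hy, not_true_eq_false, false_and, or_false]
        refine ⟨fun hw => ⟨φ, ⟨hφ, hz y φ hφ hyφ ▸ hw⟩, hyφ⟩, ?_⟩
        rintro ⟨ψ, ⟨hψ, hw⟩, hyψ⟩
        rwa [hz y ψ hψ hyψ]
      · have h1 : h y = z φ₀ := dif_neg hy
        simp only [h1, hy, not_false_eq_true, true_and, iff_or_self]
        rintro ⟨ψ, ⟨hψ, -⟩, hyψ⟩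
        exact absurd ⟨ψ, hψ, hyψ⟩ hy
    rw [this]
    exact (MeasurableSet.biUnion (Set.to_countable _) fun φ _ => hcell φ).union
      (hP.compl.inter (MeasurableSet.const _))
  refine ⟨ν.map hh.aemeasurable, ?_, fun W j x hW hzW => ?_⟩
  · have hsub : ((ν.map hh.aemeasurable : ProbabilityMeasure X) : Measure X).support ⊆
        Set.range z := by
      refine Measure.support_subset_of_isClosed (Set.finite_range z).isClosed ?_
      rw [mem_ae_iff, ProbabilityMeasure.toMeasure_map, Measure.map_apply hh
        (Set.finite_range z).measurableSet.compl]
      convert measure_empty (μ := (ν : Measure X))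
      ext y
      simp only [Set.mem_preimage, Set.mem_compl_iff, Set.mem_empty_iff_false, iff_false, not_not]
      simp only [h]
      split_ifs <;> exact Set.mem_range_self _
    refine (Set.encard_le_encard hsub).trans ?_
    rw [← Set.image_univ]
    refine (Set.encard_image_le _ _).trans ?_
    rw [Set.encard_univ, ENat.card_eq_coe_natCard]
  · rw [ProbabilityMeasure.toMeasure_map, Measure.map_apply hh hW]
    refine (measure_mono fun y hy => ?_).trans (measure_union_le _ _)
    by_cases hyP : P y
    · obtain ⟨φ, hφ, hyφ⟩ := hyP
      refine Or.inl ?_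
      rw [Set.mem_preimage, hz y φ hφ hyφ]
      refine hzW φ hφ ?_
      by_contra hne
      exact Set.disjoint_left.mp (hdisj j hne) (hyφ j) hy
    · exact Or.inr hyP

/-- If `ν` almost dominates the atoms of `μ` on disjoint sets `D x`, and these atoms exhaust `μ`,
then `ν` gives little mass to the complement of the union of the `D x`. -/
theorem measure_notMem_iUnion_le {X : Type*} [MeasurableSpace X] [MeasurableSingletonClass X]
    (μ ν : Measure X) [IsProbabilityMeasure μ] [IsProbabilityMeasure ν] (S : Finset X)
    (hS : μ (S : Set X)ᶜ = 0) (D : S → Set X) (hD : ∀ x, MeasurableSet (D x))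
    (hdisj : Pairwise (Function.onFun Disjoint D)) (ε : ENNReal)
    (h : ∀ x : S, μ {(x : X)} ≤ ν (D x) + ε) :
    ν {y | ∀ x, y ∉ D x} ≤ S.card * ε := by
  classical
  have h1 : (1 : ENNReal) ≤ ν (⋃ x, D x) + S.card * ε := by
    calc (1 : ENNReal) = ∑ x ∈ S, μ {x} := by
          rw [← measure_univ (μ := μ), measure_eq_sum_atoms μ S hS]; simp
      _ = ∑ x : S, μ {(x : X)} := (Finset.sum_coe_sort S fun x => μ {x}).symm
      _ ≤ ∑ x : S, (ν (D x) + ε) := Finset.sum_le_sum fun x _ => h x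
      _ = ν (⋃ x, D x) + S.card * ε := by
          rw [Finset.sum_add_distrib, measure_iUnion hdisj hD, tsum_fintype]; simp
  have h2 : {y | ∀ x, y ∉ D x} = (⋃ x, D x)ᶜ := by ext; simp
  rw [h2, prob_compl_eq_one_sub (MeasurableSet.iUnion hD)]
  exact tsub_le_iff_left.mpr h1

/-! ### The main theorem -/

theorem corollary1p5 {Γ X : Type*} [Group Γ] [Countable Γ] [Infinite Γ]
    [TopologicalSpace X] [CompactSpace X] [TopologicalSpace.MetrizableSpace X]
    [MeasurableSpace X] [BorelSpace X] [MulAction Γ X] [ContinuousConstSMul Γ X]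
    (k : ℕ) (hk : 1 ≤ k) (N : Fin k → ℕ) (hN : ∀ j, 1 ≤ N j) :
    (Set.univ.pi fun j => (finSuppMeasures Γ X (N j) : Set (ProbabilityMeasure X))) ∩
        INTuples Γ (ProbabilityMeasure X) k ⊆
      (fun (ν : Fin k → finSuppMeasures Γ X (∏ j, N j)) (j : Fin k) =>
        (ν j : ProbabilityMeasure X)) '' INTuples Γ (finSuppMeasures Γ X (∏ j, N j)) k := by
  classical
  rintro μ ⟨hμN, hμIN⟩
  have hμN' : ∀ j, (μ j : Measure X).support.encard ≤ N j := fun j => hμN j (Set.mem_univ j)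
  have hfin : ∀ j, (μ j : Measure X).support.Finite := fun j =>
    Set.finite_of_encard_le_coe (hμN' j)
  let S : Fin k → Finset X := fun j => (hfin j).toFinset
  have hScard : ∀ j, (S j).card ≤ N j := by
    intro j
    have := hμN' j
    rw [(hfin j).encard_eq_coe_toFinset_card] at this
    exact_mod_cast this
  have hS0 : ∀ j, (μ j : Measure X) (S j : Set X)ᶜ = 0 := by
    intro j
    rw [Set.Finite.coe_toFinset]
    exact Measure.measure_compl_support
  have hNle : ∀ j, N j ≤ ∏ j, N j := fun j =>
    Finset.single_le_prod' (fun i _ => hN i) (Finset.mem_univ j)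
  refine ⟨fun j => ⟨μ j, (hμN' j).trans (by exact_mod_cast hNle j)⟩, ?_, rfl⟩
  intro U hU n
  have hU' : ∀ j, ∃ U' ∈ 𝓝 (μ j), ∀ ρ : finSuppMeasures Γ X (∏ j, N j),
      (ρ : ProbabilityMeasure X) ∈ U' → ρ ∈ U j := by
    intro j
    obtain ⟨U', hU', hsub⟩ := mem_nhds_induced _ _ _ |>.mp (hU j)
    exact ⟨U', hU', fun ρ hρ => hsub hρ⟩
  choose U' hU'μ hU'U using hU'
  choose V ε hε hV hdisj hVU using fun j =>
    exists_forall_measure_le_imp_mem (μ j) (S j) (hS0 j) (hU'μ j)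
  obtain ⟨η, hη0, hη1, hηε⟩ : ∃ η : ENNReal, 0 < η ∧ η < 1 ∧ ∀ j, η ≤ ε j := by
    refine ⟨min (1 / 2) (Finset.univ.inf ε), lt_min (by simp) ?_, ?_, fun j => ?_⟩
    · exact (Finset.lt_inf_iff ENNReal.zero_lt_top).mpr fun j _ => hε j
    · exact (min_le_left _ _).trans_lt (by simp)
    · exact (min_le_right _ _).trans (Finset.inf_le (Finset.mem_univ j))
  have hηtop : η ≠ ⊤ := (hη1.trans ENNReal.one_lt_top).ne
  have hη2 : 0 < η / 2 := ENNReal.half_pos hη0.ne'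
  let C : ℕ := ∑ j, (S j).card
  -- The total loss is `η / 2` from choices outside `G`, `C * ε'` from points outside the sets `D j
  -- x`, and `ε'` from comparing `ν` with `μ j`.
  let ε' : ENNReal := η / 2 / (C + 1 : ℕ)
  have hε' : 0 < ε' := ENNReal.div_pos hη2.ne' (by finiteness)
  have hsum : η / 2 + C * ε' + ε' = η := by
    have : ((C + 1 : ℕ) : ENNReal) * ε' = η / 2 :=
      ENNReal.mul_div_cancel (by simp) (by finiteness)
    rw [add_assoc, ← add_one_mul, ← Nat.cast_add_one, this, ENNReal.add_halves]
  let D : ∀ j, S j → Set X := fun j x => V j x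
  have hDo : ∀ j x, IsOpen (D j x) := fun j x => (hV j x x.2).1
  have hDd : ∀ j, Pairwise (Function.onFun Disjoint (D j)) := fun j x y hxy =>
    hdisj j x.2 y.2 (Subtype.coe_injective.ne hxy)
  obtain ⟨M, hM⟩ := exists_independent_choices hk D (fun j x => (hDo j x).measurableSet) n hη2
  obtain ⟨F, hFM, hF⟩ := hμIN _
    (fun j => setOf_forall_measure_le_mem_nhds (μ j) (S j) (V j) (hV j) hε') (max M 1)
  let γ : ℕ → Γ := fun i => if h : i < F.card then F.equivFin.symm ⟨i, h⟩ else 1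
  have hγ : ∀ i (h : i < F.card), γ i = F.equivFin.symm ⟨i, h⟩ := fun i h => dif_pos h
  have hγinj : Set.InjOn γ (Finset.range F.card : Set ℕ) := by
    intro i hi i' hi' h
    rw [Finset.mem_coe, Finset.mem_range] at hi hi'
    rw [hγ i hi, hγ i' hi'] at h
    simpa using F.equivFin.symm.injective (Subtype.coe_injective h)
  obtain ⟨σ, A, G, hAs, hAn, hG, hσ⟩ := hM (fun i y => γ i • y)
    (fun i => measurable_const_smul (γ i)) (Finset.range F.card)
    (by rw [Finset.card_range]; exact (le_max_left _ _).trans hFM)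
  -- a measure realising the pattern `σ` along all of `F`
  obtain ⟨ν, hν⟩ := hF F (Finset.card_pos.mp (by omega)) subset_rfl fun s => σ (F.equivFin s)
  obtain ⟨e, he, hbad⟩ := hσ ν inferInstance
  have hνμ : ∀ j, ∀ x : S j,
      (μ j : Measure X) {(x : X)} ≤ (ν : Measure X) ((fun y => γ (e j) • y) ⁻¹' D j x) + ε' := by
    intro j x
    have hlt : e j < F.card := Finset.mem_range.mp (he j).1
    have h := Set.mem_iInter.mp hν (F.equivFin.symm ⟨e j, hlt⟩)
    simp only [Set.mem_preimage, Equiv.apply_symm_apply, (he j).2, ← hγ _ hlt] at h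
    have h' := h x x.2
    rwa [probabilityMeasure_toMeasure_smul, Measure.map_apply (measurable_const_smul _)
      (hDo j x).measurableSet] at h'
  have hDm : ∀ j (x : S j), MeasurableSet ((fun y => γ (e j) • y) ⁻¹' D j x) := fun j x =>
    measurable_const_smul _ (hDo j x).measurableSet
  have hDd' : ∀ j, Pairwise (Function.onFun Disjoint
      fun x => (fun y => γ (e j) • y) ⁻¹' D j x) := fun j x y hxy =>
    (hDd j hxy).preimage _
  let B : Set X := {y | ¬ ∃ φ ∈ G, ∀ j, y ∈ (fun y => γ (e j) • y) ⁻¹' D j (φ j)}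
  have hB : (ν : Measure X) B ≤ η / 2 + C * ε' := by
    have hsub : B ⊆ {y | ∃ φ ∉ G, ∀ j, γ (e j) • y ∈ D j (φ j)} ∪
        ⋃ j, {y | ∀ x, y ∉ (fun y => γ (e j) • y) ⁻¹' D j x} := by
      intro y hy
      by_cases hex : ∀ j, ∃ x, y ∈ (fun y => γ (e j) • y) ⁻¹' D j x
      · choose φ hφ using hex
        exact Or.inl ⟨φ, fun hφG => hy ⟨φ, hφG, hφ⟩, hφ⟩
      · push Not at hex
        exact Or.inr (Set.mem_iUnion.mpr hex)
    refine (measure_mono hsub).trans ((measure_union_le _ _).trans ?_)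
    refine add_le_add hbad ?_
    refine (measure_iUnion_fintype_le _ _).trans ?_
    rw [Nat.cast_sum, Finset.sum_mul]
    exact Finset.sum_le_sum fun j _ => measure_notMem_iUnion_le (μ j : Measure X) _ (S j)
      (hS0 j) _ (hDm j) (hDd' j) ε' (hνμ j)
  -- If `G` were empty, `B` would have full mass, against `η < 1`.
  have hGne : G.Nonempty := by
    by_contra hne
    rw [Set.not_nonempty_iff_eq_empty] at hne
    have hBu : B = Set.univ := by ext; simp [B, hne]
    rw [hBu, measure_univ] at hB
    exact (hB.trans (le_self_add.trans hsum.le)).not_gt hη1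
  refine ⟨A.image γ, ?_, ?_⟩
  · rw [Finset.card_image_of_injOn (hγinj.mono (Finset.coe_subset.mpr hAs)), hAn]
  intro J _ hJ τ'
  let τ : ℕ → Fin k := fun i => if h : γ i ∈ J then τ' ⟨γ i, h⟩ else ⟨0, hk⟩
  have hz : ∀ φ, ∃ z : X, φ ∈ G → ∀ i ∈ A, γ i • z ∈ D (τ i) (φ (τ i)) := by
    intro φ
    by_cases hφ : φ ∈ G
    · obtain ⟨z, hz⟩ := hG φ hφ τ
      exact ⟨z, fun _ => hz⟩
    · obtain ⟨z⟩ := ν.nonempty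
      exact ⟨z, fun h => absurd h hφ⟩
  choose z hz using hz
  obtain ⟨ρ, hρsupp, hρ⟩ := exists_finite_support_measure _ hDm hDd' ν G hGne z
  have hρN : ρ ∈ finSuppMeasures Γ X (∏ j, N j) := by
    refine hρsupp.trans ?_
    rw [Nat.card_pi]
    refine Nat.cast_le.mpr (Finset.prod_le_prod' fun j _ => ?_)
    rw [Nat.card_eq_fintype_card, Fintype.card_coe]
    exact hScard j
  refine ⟨⟨ρ, hρN⟩, Set.mem_iInter.mpr fun s => hU'U _ _ (hVU _ _ fun x hx => ?_)⟩
  obtain ⟨i, hiA, his⟩ := Finset.mem_image.mp (Finset.mem_coe.mp (hJ s.2))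
  have hτi : τ i = τ' s := by
    have hmem : γ i ∈ J := his ▸ s.2
    simp only [τ, dif_pos hmem]
    congr 1
    exact Subtype.ext his
  -- The translate by `s` of `ρ` inherits at `V (τ' s) x` the mass `ν` has on the cell of `x` in the
  -- good block, up to `ν B`.
  have hρx := hρ ((fun y => (s : Γ) • y) ⁻¹' V (τ' s) x) (τ' s) ⟨x, hx⟩
    (measurable_const_smul _ (hV _ x hx).1.measurableSet) fun φ hφ hφx => by
      have h := hz φ hφ i hiA
      rw [hτi, hφx, his] at h
      exact h
  have hval : ((((s : Γ) • (⟨ρ, hρN⟩ : finSuppMeasures Γ X (∏ j, N j)) :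
      finSuppMeasures Γ X (∏ j, N j)) : ProbabilityMeasure X) : Measure X) (V (τ' s) x) =
      (ρ : Measure X) ((fun y => (s : Γ) • y) ⁻¹' V (τ' s) x) := by
    rw [SubMulAction.val_smul, probabilityMeasure_toMeasure_smul,
      Measure.map_apply (measurable_const_smul _) (hV _ x hx).1.measurableSet]
  rw [hval]
  calc (μ (τ' s) : Measure X) {x} ≤ _ := hνμ (τ' s) ⟨x, hx⟩
    _ ≤ (ρ : Measure X) ((fun y => (s : Γ) • y) ⁻¹' V (τ' s) x) + (η / 2 + C * ε') + ε' := by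
        gcongr
        exact hρx.trans (by gcongr)
    _ = (ρ : Measure X) ((fun y => (s : Γ) • y) ⁻¹' V (τ' s) x) + η := by
        rw [add_assoc, hsum]
    _ ≤ (ρ : Measure X) ((fun y => (s : Γ) • y) ⁻¹' V (τ' s) x) + ε (τ' s) := by
        gcongr
        exact hηε _
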